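/- Let $C_d>1$. There is a constant $C=C(C_d)>0$, depending only on $C_d$, such that the following holds. Let $(X,d)$ be a complete metric space and $\mu$ a Borel measure on $X$ with $$0<\mu(B(x,2r))\le C_d\,\mu(B(x,r))<\infty\qquad\text{for all }x\in X,\ r>0,$$ where $B(x,r)$ denotes the open ball. Assume that $X$ satisfies an annular decay property: there are $0\le\alpha\le1$ and $K\ge1$ such that $\mu\big(B(x,r)\setminus B(x,(1-\delta)r)\big)\le K\delta^\alpha\mu(B(x,r))$ for all $x\in X$, $r>0$, $0<\delta<1$. For a real-valued $f\in L^1_{\mathrm{loc}}(X)$ let $f_B=\frac1{\mu(B)}\int_B f\,d\mu$ and $$\|f\|_{BMO}=\sup_{B}\frac1{\mu(B)}\int_B|f-f_B|\,d\mu,\qquad \|f\|_{BUO}=\sup_{B}\Big(\operatorname*{ess\,sup}_{B}f-f_B\Big),$$ the suprema being over all balls $B\subset X$; $BMO(X)$ and $BUO(X)$ consist of the $f\in L^1_{\mathrm{loc}}(X)$ (defined and finite almost everywhere) for which the respective quantity is finite. Define the natural minimal function and the minimal function of $f$ by $$m^\natural f(x)=\inf_{B\ni x}\frac1{\mu(B)}\int_B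 f\,d\mu\in[-\infty,\infty),\qquad mf(x)=\inf_{B\ni x}\frac1{\mu(B)}\int_B |f|\,d\mu,$$ the infima being over all balls containing $x$. Let $f\in BMO(X)$. Then 1. if $m^\natural f$ is not identically $-\infty$, then $m^\natural f\in BUO(X)$ and $\|m^\natural f\|_{BUO}\le C\|f\|_{BMO}$; 2. $mf\in BUO(X)$ and $\|mf\|_{BUO}\le C\|f\|_{BMO}$. -/

import Mathlib

open MeasureTheory Metric

universe u

noncomputable section

namespace MetricOscillation

variable {X : Type*} [MetricSpace X] [MeasurableSpace X]

/-- The doubling condition with constant `Cd`: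
`0 < μ(2B) ≤ Cd μ(B) < ∞` for every ball `B = B(x, r)`. -/
def IsDoubling (μ : Measure X) (Cd : ℝ) : Prop :=
  ∀ (x : X) (r : ℝ), 0 < r →
    0 < μ (ball x (2 * r)) ∧
    μ (ball x (2 * r)) ≤ ENNReal.ofReal Cd * μ (ball x r) ∧
    μ (ball x r) < ⊤

/-- The `α`-annular decay property. -/
def AnnularDecay (μ : Measure X) (α : ℝ) : Prop :=
  ∃ C : ℝ, 1 ≤ C ∧ ∀ (x : X) (r δ : ℝ), 0 < r → 0 < δ → δ < 1 →
    μ (ball x r \ ball x ((1 - δ) * r)) ≤ ENNReal.ofReal (C * δ ^ α) * μ (ball x r)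

/-- An annular decay property: `α`-annular decay for some `0 ≤ α ≤ 1`. -/
def HasAnnularDecay (μ : Measure X) : Prop :=
  ∃ α : ℝ, 0 ≤ α ∧ α ≤ 1 ∧ AnnularDecay μ α

/-- `‖f‖_BMO = sup_B ⨍_B |f - f_B|`. -/
def bmoNorm (μ : Measure X) (f : X → ℝ) : EReal :=
  ⨆ (c : X) (r : ℝ) (_ : 0 < r),
    ((⨍ y in ball c r, |f y - ⨍ z in ball c r, f z ∂μ| ∂μ : ℝ) : EReal)

/-- `f ∈ BMO`: `f` is locally integrable and `‖f‖_BMO < ∞`. -/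
def MemBMO (μ : Measure X) (f : X → ℝ) : Prop :=
  LocallyIntegrable f μ ∧ bmoNorm μ f < ⊤

/-- `‖g‖_BUO = sup_B (ess sup_B g - ⨍_B g)`, for an extended real valued `g`
which is finite almost everywhere. -/
def buoNorm (μ : Measure X) (g : X → EReal) : EReal :=
  ⨆ (c : X) (r : ℝ) (_ : 0 < r),
    (essSup g (μ.restrict (ball c r)) - ((⨍ y in ball c r, (g y).toReal ∂μ : ℝ) : EReal))

/-- `g ∈ BUO`: `g` is finite almost everywhere, locally integrable, and `‖g‖_BUO < ∞`. -/
def MemBUO (μ : Measure X) (g : X → EReal) : Prop :=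
  (∀ᵐ x ∂μ, g x ≠ ⊥ ∧ g x ≠ ⊤) ∧
  LocallyIntegrable (fun x => (g x).toReal) μ ∧
  buoNorm μ g < ⊤

/-- The natural minimal function `m^♮ f (x) = inf_{B ∋ x} ⨍_B f`, over all balls containing `x`. -/
def naturalMinimal (μ : Measure X) (f : X → ℝ) (x : X) : EReal :=
  ⨅ (c : X) (r : ℝ) (_ : 0 < r) (_ : x ∈ ball c r), ((⨍ y in ball c r, f y ∂μ : ℝ) : EReal)

/-- The minimal function `m f (x) = inf_{B ∋ x} ⨍_B |f|`, over all balls containing `x`. -/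
def minimal (μ : Measure X) (f : X → ℝ) (x : X) : EReal :=
  ⨅ (c : X) (r : ℝ) (_ : 0 < r) (_ : x ∈ ball c r), ((⨍ y in ball c r, |f y| ∂μ : ℝ) : EReal)

end MetricOscillation

end

namespace MetricOscillation

variable {X : Type*} [MetricSpace X] [MeasurableSpace X]

/-! ### Doubling measures: comparing balls, total boundedness, integrability on balls. -/

section Doubling

variable {μ : Measure X} {Cd : ℝ}

/-! Fix a ball `B = B(c, r)` and x, y in B. For almost every x the value of the minimal function at
x is at least its value at y, minus an error N(x) + Cd ^ 5 * D, where D bounds the mean oscillation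
and N = `totalDrop` records how far averages over small balls at x fall below the average over 2B.
Small balls are handled by N, since 2B contains y and so has average at least the value at y. A
large ball at x becomes, after enlargement by a fixed factor, a ball containing y, and enlarging
moves the average by at most a multiple of D (`OscLE.sub_le_naturalMinimal`). Averaging in x gives
the BUO bound once N has average O(D) over B.

That estimate is `OscLE.lintegral_averageDrop_le_of_lt`, a Calderón–Zygmund stopping argument. With
scales truncated below at ε, one selects disjoint balls on which the drop exceeds a threshold l.
Their total measure is O(D / l) times that of B, and on a fivefold enlargement of each, the drop of
B is at most the drop of that enlargement plus O(l + D). The enlargements have at most half the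
radius of B, so induction on scale closes when l is a large enough multiple of D; monotone
convergence removes ε.

The second claim is the first one for |f|, whose oscillation is at most 2D. -/

theorem IsDoubling.measure_ball_pos (hμ : IsDoubling μ Cd) (x : X) {r : ℝ} (hr : 0 < r) :
    0 < μ (ball x r) := by
  have h := (hμ x (r / 2) (by positivity)).1
  rwa [mul_div_cancel₀ r two_ne_zero] at h

theorem IsDoubling.measure_ball_lt_top (hμ : IsDoubling μ Cd) (x : X) {r : ℝ} (hr : 0 < r) :
    μ (ball x r) < ⊤ :=
  (hμ x r hr).2.2

theorem IsDoubling.real_ball_pos (hμ : IsDoubling μ Cd) (x : X) {r : ℝ} (hr : 0 < r) :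
    0 < μ.real (ball x r) :=
  ENNReal.toReal_pos (hμ.measure_ball_pos x hr).ne' (hμ.measure_ball_lt_top x hr).ne

theorem IsDoubling.measure_ball_two_pow_mul_le (hμ : IsDoubling μ Cd) (hCd : 1 < Cd)
    (k : ℕ) (x : X) {r : ℝ} (hr : 0 < r) :
    μ (ball x (2 ^ k * r)) ≤ ENNReal.ofReal (Cd ^ k) * μ (ball x r) := by
  induction k with
  | zero => simp
  | succ k ih =>
    have h := (hμ x (2 ^ k * r) (by positivity)).2.1
    rw [show (2 : ℝ) ^ (k + 1) * r = 2 * (2 ^ k * r) by ring, pow_succ',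
      ENNReal.ofReal_mul (by linarith), mul_assoc]
    exact h.trans (by gcongr)

theorem IsDoubling.measure_ball_le (hμ : IsDoubling μ Cd) (hCd : 1 < Cd) (k : ℕ)
    {x y : X} {r s : ℝ} (hr : 0 < r) (h : s + dist y x ≤ 2 ^ k * r) :
    μ (ball y s) ≤ ENNReal.ofReal (Cd ^ k) * μ (ball x r) :=
  (measure_mono (ball_subset_ball' h)).trans (hμ.measure_ball_two_pow_mul_le hCd k x hr)

theorem IsDoubling.real_ball_le (hμ : IsDoubling μ Cd) (hCd : 1 < Cd) (k : ℕ)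
    {x y : X} {r s : ℝ} (hr : 0 < r) (h : s + dist y x ≤ 2 ^ k * r) :
    μ.real (ball y s) ≤ Cd ^ k * μ.real (ball x r) := by
  have h1 := hμ.measure_ball_le hCd k hr h
  have h2 := ENNReal.toReal_mono
    (ENNReal.mul_ne_top ENNReal.ofReal_ne_top (hμ.measure_ball_lt_top x hr).ne) h1
  rwa [ENNReal.toReal_mul, ENNReal.toReal_ofReal (by positivity)] at h2

/-- Disjoint balls of equal radius δ centred in the ball have measure bounded below by doubling and
lie in a set of finite measure, so a maximal Vitali family is finite. With completeness this makes
closed balls compact, so locally integrable functions are integrable on balls. -/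
theorem IsDoubling.totallyBounded_ball [BorelSpace X] (hμ : IsDoubling μ Cd) (hCd : 1 < Cd)
    (c : X) {R : ℝ} (hR : 0 < R) : TotallyBounded (ball c R) := by
  refine Metric.totallyBounded_iff.2 fun ε hε => ?_
  set δ := min (ε / 5) R with hδ
  have hδ0 : 0 < δ := by positivity
  obtain ⟨u, hut, hdisj, hcov⟩ := Vitali.exists_disjoint_subfamily_covering_enlargement_ball
    (ball c R) id (fun _ => δ) δ (fun _ _ => le_rfl) 5 (by norm_num)
  obtain ⟨k, hk⟩ := pow_unbounded_of_one_lt (2 * R / δ) (one_lt_two : (1 : ℝ) < 2)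
  rw [div_lt_iff₀ hδ0] at hk
  have hfin : μ (⋃ i : u, ball (i : X) δ) ≠ ⊤ := by
    refine ne_top_of_le_ne_top
      (hμ.measure_ball_lt_top c (r := 2 * R) (by positivity)).ne (measure_mono ?_)
    refine Set.iUnion_subset fun i => ball_subset_ball' ?_
    have := mem_ball.1 (hut i.2)
    have := min_le_right (ε / 5) R
    linarith
  have hCk : 0 < Cd ^ k := by positivity
  have hf := Measure.finite_const_le_meas_of_disjoint_iUnion μ
    (ε := μ (ball c R) / ENNReal.ofReal (Cd ^ k))
    (ENNReal.div_pos (hμ.measure_ball_pos c hR).ne' ENNReal.ofReal_ne_top)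
    (As := fun i : u => ball (i : X) δ) (fun i => measurableSet_ball)
    (fun i j hij => hdisj i.2 j.2 (fun h => hij (Subtype.ext h))) hfin
  have huniv : {i : u | μ (ball c R) / ENNReal.ofReal (Cd ^ k) ≤ μ (ball (i : X) δ)}
      = Set.univ := by
    refine Set.eq_univ_of_forall fun i => ?_
    refine ENNReal.div_le_of_le_mul' (hμ.measure_ball_le hCd k hδ0 ?_)
    have := mem_ball'.1 (hut i.2)
    linarith
  rw [huniv, Set.finite_univ_iff] at hf
  refine ⟨u, hf, fun x hx => ?_⟩
  obtain ⟨b, hb, hsub⟩ := hcov x hx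
  refine Set.mem_biUnion hb (ball_subset_ball ?_ (hsub (mem_ball_self hδ0)))
  have := min_le_left (ε / 5) R
  linarith

theorem IsDoubling.integrableOn_ball [BorelSpace X] [CompleteSpace X] (hμ : IsDoubling μ Cd)
    (hCd : 1 < Cd) {f : X → ℝ} (hf : LocallyIntegrable f μ) (c : X) (r : ℝ) :
    IntegrableOn f (ball c r) μ := by
  have hcpt : IsCompact (closedBall c r) := by
    refine isCompact_iff_totallyBounded_isComplete.2 ⟨?_, isClosed_closedBall.isComplete⟩
    exact (hμ.totallyBounded_ball hCd c (R := |r| + 1) (by positivity)).subset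
      (closedBall_subset_ball (by linarith [le_abs_self r]))
  exact (hf.integrableOn_isCompact hcpt).mono_set ball_subset_closedBall

theorem IsDoubling.sigmaFinite (hμ : IsDoubling μ Cd) : SigmaFinite μ := by
  rcases isEmpty_or_nonempty X with h | ⟨⟨x⟩⟩
  · rw [Measure.eq_zero_of_isEmpty μ]; infer_instance
  · refine ⟨⟨⟨fun n : ℕ => ball x (n + 1), fun _ => trivial,
      fun n => hμ.measure_ball_lt_top x (by positivity), ?_⟩⟩⟩
    refine Set.eq_univ_of_forall fun y => Set.mem_iUnion.2 ?_
    obtain ⟨n, hn⟩ := exists_nat_gt (dist y x)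
    exact ⟨n, mem_ball.2 (by linarith)⟩

end Doubling

/-! ### Bounded mean oscillation: averages over comparable balls differ by O(D). -/

/-- A function integrable on all balls whose mean oscillation on each ball is at most `D`. -/
structure OscLE (μ : Measure X) (f : X → ℝ) (D : ℝ) : Prop where
  integrableOn : ∀ (c : X) (r : ℝ), IntegrableOn f (ball c r) μ
  le : ∀ (c : X) (r : ℝ), 0 < r →
    ⨍ y in ball c r, |f y - ⨍ z in ball c r, f z ∂μ| ∂μ ≤ D

section Average

variable {μ : Measure X} {Cd D : ℝ} {f : X → ℝ}

theorem abs_setAverage_sub_le {Y : Type*} [MeasurableSpace Y] {μ : Measure Y} {f : Y → ℝ}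
    {s : Set Y} (h0 : 0 < μ.real s) (hs : μ s ≠ ⊤)
    (hf : IntegrableOn f s μ) (a : ℝ) :
    μ.real s * |(⨍ y in s, f y ∂μ) - a| ≤ ∫ y in s, |f y - a| ∂μ := by
  have h1 : ∫ y in s, (f y - a) ∂μ = μ.real s * ((⨍ y in s, f y ∂μ) - a) := by
    rw [integral_sub hf (integrableOn_const hs), setAverage_eq, setIntegral_const]
    simp only [smul_eq_mul]
    field_simp
  rw [← abs_of_pos h0, ← abs_mul, ← h1]
  exact abs_integral_le_integral_abs

theorem OscLE.integral_le (hf : OscLE μ f D) (hμ : IsDoubling μ Cd) (c : X) {r : ℝ} (hr : 0 < r) :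
    ∫ y in ball c r, |f y - ⨍ z in ball c r, f z ∂μ| ∂μ ≤ D * μ.real (ball c r) := by
  have h := hf.le c r hr
  have h0 := hμ.real_ball_pos c hr
  rwa [setAverage_eq, smul_eq_mul, inv_mul_le_iff₀ h0, mul_comm] at h

theorem OscLE.integrableOn_abs_sub (hf : OscLE μ f D) (hμ : IsDoubling μ Cd) (c : X) {r : ℝ}
    (hr : 0 < r) (a : ℝ) : IntegrableOn (fun y => |f y - a|) (ball c r) μ :=
  ((hf.integrableOn c r).sub (integrableOn_const (hμ.measure_ball_lt_top c hr).ne)).abs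

theorem OscLE.abs_sub_le_of_subset (hf : OscLE μ f D) (hμ : IsDoubling μ Cd) (hCd : 1 < Cd)
    (k : ℕ) {x y : X} {r s : ℝ} (hr : 0 < r) (hs : 0 < s)
    (hsub : ball x r ⊆ ball y s) (h : s + dist y x ≤ 2 ^ k * r) :
    |(⨍ z in ball x r, f z ∂μ) - ⨍ z in ball y s, f z ∂μ| ≤ Cd ^ k * D := by
  have h0 := hμ.real_ball_pos x hr
  have h1 := hμ.real_ball_pos y hs
  have hD : 0 ≤ D := by
    by_contra hD
    have := hf.integral_le hμ y hs
    have h3 : 0 ≤ ∫ z in ball y s, |f z - ⨍ z in ball y s, f z ∂μ| ∂μ :=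
      integral_nonneg fun _ => abs_nonneg _
    nlinarith
  have key : μ.real (ball x r) * |(⨍ z in ball x r, f z ∂μ) - ⨍ z in ball y s, f z ∂μ|
      ≤ μ.real (ball x r) * (Cd ^ k * D) := by
    calc _ ≤ ∫ w in ball x r, |f w - ⨍ z in ball y s, f z ∂μ| ∂μ :=
          abs_setAverage_sub_le h0 (hμ.measure_ball_lt_top x hr).ne (hf.integrableOn x r) _
      _ ≤ ∫ w in ball y s, |f w - ⨍ z in ball y s, f z ∂μ| ∂μ :=
          setIntegral_mono_set (hf.integrableOn_abs_sub hμ y hs _)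
            (Filter.Eventually.of_forall fun _ => abs_nonneg _) hsub.eventuallyLE
      _ ≤ D * μ.real (ball y s) := hf.integral_le hμ y hs
      _ ≤ D * (Cd ^ k * μ.real (ball x r)) := by gcongr; exact hμ.real_ball_le hCd k hr h
      _ = _ := by ring
  exact le_of_mul_le_mul_left key h0

theorem OscLE.nonneg (hf : OscLE μ f D) (x : X) : 0 ≤ D :=
  le_trans (by rw [setAverage_eq]; positivity) (hf.le x 1 one_pos)

/-- Both averages are compared with the one over `ball x (r + s + dist x y)`, which contains both
balls. It is centred at x, so the comparison with the ball at y costs one extra doubling. -/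
theorem OscLE.abs_sub_le (hf : OscLE μ f D) (hμ : IsDoubling μ Cd) (hCd : 1 < Cd)
    (k : ℕ) {x y : X} {r s : ℝ} (hr : 0 < r) (hs : 0 < s)
    (h1 : r + s + dist x y ≤ 2 ^ k * r) (h2 : r + s + dist x y ≤ 2 ^ k * s) :
    |(⨍ z in ball x r, f z ∂μ) - ⨍ z in ball y s, f z ∂μ| ≤ 2 * Cd ^ (k + 1) * D := by
  have hd := dist_nonneg (x := x) (y := y)
  have e1 := hf.abs_sub_le_of_subset hμ hCd k (y := x) (s := r + s + dist x y) hr (by positivity)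
    (ball_subset_ball (by linarith)) (by simpa using h1)
  have e2 := hf.abs_sub_le_of_subset hμ hCd (k + 1) (y := x) (s := r + s + dist x y) hs
    (by positivity) (ball_subset_ball' (by rw [dist_comm y x]; linarith)) (by
      rw [pow_succ]; nlinarith)
  have hD := hf.nonneg x
  have e3 : Cd ^ k * D ≤ Cd ^ (k + 1) * D := by
    gcongr
    · exact hCd.le
    · omega
  rw [abs_le] at *
  constructor <;> linarith [e1.1, e1.2, e2.1, e2.2]

end Average

/-! ### Integral estimate for the drop of averages, by a stopping-time argument. -/

/-- The average of `f` over the ball `B(c, r)`. -/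
noncomputable abbrev ballAverage (μ : Measure X) (f : X → ℝ) (c : X) (r : ℝ) : ℝ :=
  ⨍ y in ball c r, f y ∂μ

/-- The largest amount by which the averages of `f` over balls `B(c', s) ∋ x` with
`ε ≤ s ≤ r / 10` fall below the average over `B(c, 2 * r)`. -/
noncomputable def averageDrop (μ : Measure X) (f : X → ℝ) (c : X) (r ε : ℝ) (x : X) : ENNReal :=
  ⨆ (c' : X) (s : ℝ) (_ : ε ≤ s ∧ s ≤ r / 10 ∧ x ∈ ball c' s),
    ENNReal.ofReal (ballAverage μ f c (2 * r) - ballAverage μ f c' s)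

section AverageDrop

variable {μ : Measure X} {Cd D : ℝ} {f : X → ℝ}

theorem le_averageDrop {c c' x : X} {r ε s : ℝ} (h1 : ε ≤ s) (h2 : s ≤ r / 10)
    (h3 : x ∈ ball c' s) :
    ENNReal.ofReal (ballAverage μ f c (2 * r) - ballAverage μ f c' s)
      ≤ averageDrop μ f c r ε x :=
  le_iSup_of_le c' <| le_iSup_of_le s <| le_iSup_of_le ⟨h1, h2, h3⟩ le_rfl

theorem lt_averageDrop_iff {c x : X} {r ε : ℝ} {a : ENNReal} :
    a < averageDrop μ f c r ε x ↔ ∃ (c' : X) (s : ℝ), (ε ≤ s ∧ s ≤ r / 10 ∧ x ∈ ball c' s) ∧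
      a < ENNReal.ofReal (ballAverage μ f c (2 * r) - ballAverage μ f c' s) := by
  simp only [averageDrop, lt_iSup_iff, exists_prop]

theorem measurable_averageDrop [BorelSpace X] (c : X) (r ε : ℝ) :
    Measurable (averageDrop μ f c r ε) := by
  refine measurable_of_Ioi fun a => IsOpen.measurableSet ?_
  refine isOpen_iff_mem_nhds.2 fun x hx => ?_
  obtain ⟨c', s, ⟨h1, h2, h3⟩, h⟩ := lt_averageDrop_iff.1 hx
  filter_upwards [isOpen_ball.mem_nhds h3] with y hy
  exact lt_averageDrop_iff.2 ⟨c', s, ⟨h1, h2, hy⟩, h⟩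

/-- Vitali selection among the balls with drop above l. The last clause is the stopping condition:
at x, no admissible ball much larger than the selected one has drop above l. -/
theorem exists_disjoint_balls_of_lt_averageDrop (c : X) (r : ℝ) {ε l : ℝ} (hε : 0 < ε)
    (hl : 0 ≤ l) :
    ∃ u : Set (X × ℝ), u.PairwiseDisjoint (fun b => ball b.1 b.2) ∧
      (∀ b ∈ u, ε ≤ b.2 ∧ b.2 ≤ r / 10 ∧ (ball b.1 b.2 ∩ ball c r).Nonempty ∧
        l < ballAverage μ f c (2 * r) - ballAverage μ f b.1 b.2) ∧
      ∀ x ∈ ball c r, ENNReal.ofReal l < averageDrop μ f c r ε x →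
        ∃ b ∈ u, x ∈ ball b.1 (5 * b.2) ∧ ∀ c' s, ε ≤ s → s ≤ r / 10 → x ∈ ball c' s →
          l < ballAverage μ f c (2 * r) - ballAverage μ f c' s → s ≤ 4 * b.2 := by
  set t : Set (X × ℝ) := {b | ε ≤ b.2 ∧ b.2 ≤ r / 10 ∧ (ball b.1 b.2 ∩ ball c r).Nonempty ∧
        l < ballAverage μ f c (2 * r) - ballAverage μ f b.1 b.2} with ht
  obtain ⟨u, hut, hdisj, hcov⟩ := Vitali.exists_disjoint_subfamily_covering_enlargement
    (fun b : X × ℝ => ball b.1 b.2) t (fun b => b.2) 2 one_lt_two (fun b hb => hε.le.trans hb.1)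
    (r / 10) (fun b hb => hb.2.1) (fun b hb => hb.2.2.1.mono Set.inter_subset_left)
  refine ⟨u, hdisj, fun b hb => hut hb, fun x hx hlt => ?_⟩
  obtain ⟨c₀, s₀, ⟨h1, h2, h3⟩, h⟩ := lt_averageDrop_iff.1 hlt
  replace h := ((ENNReal.ofReal_lt_ofReal_iff_of_nonneg hl).1 h)
  set S : Set ℝ := {s | ∃ c', (c', s) ∈ t ∧ x ∈ ball c' s} with hS
  have h0S : s₀ ∈ S := ⟨c₀, ⟨h1, h2, ⟨x, h3, hx⟩, h⟩, h3⟩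
  have hbdd : BddAbove S := ⟨r / 10, fun s ⟨c', hc', _⟩ => hc'.2.1⟩
  have hpos : 0 < sSup S := (hε.trans_le h1).trans_le (le_csSup hbdd h0S)
  -- A nearly largest bad ball at x: its radius exceeds half the supremum, and Vitali loses another
  -- factor 2, whence the 4 in the stopping condition.
  obtain ⟨s₁, ⟨c₁, hs₁, hx₁⟩, hlt₁⟩ := exists_lt_of_lt_csSup ⟨_, h0S⟩ (half_lt_self hpos)
  obtain ⟨b, hb, ⟨z, hz1, hz2⟩, hle⟩ := hcov _ hs₁
  refine ⟨b, hb, ?_, fun c' s g1 g2 g3 g4 => ?_⟩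
  · rw [mem_ball] at *
    have := dist_triangle x c₁ b.1
    have := dist_triangle_left c₁ b.1 z
    simp only at *
    linarith
  · have := le_csSup hbdd (show s ∈ S from ⟨c', ⟨g1, g2, ⟨x, g3, hx⟩, g4⟩, g3⟩)
    simp only at *
    linarith

/-- Chebyshev: l times the measure of each ball is at most the integral of |f - a| over it, and
disjointness bounds the sum by the oscillation integral over `ball c (2 * r)`. -/
theorem OscLE.mul_tsum_measure_le [BorelSpace X] (hf : OscLE μ f D) (hμ : IsDoubling μ Cd)
    (c : X) {r l : ℝ} (hr : 0 < r) (hl : 0 ≤ l) {u : Set (X × ℝ)} (hu : u.Countable)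
    (hdisj : u.PairwiseDisjoint (fun b => ball b.1 b.2))
    (h : ∀ b ∈ u, 0 < b.2 ∧ ball b.1 b.2 ⊆ ball c (2 * r) ∧
      l < ballAverage μ f c (2 * r) - ballAverage μ f b.1 b.2) :
    ENNReal.ofReal l * ∑' b : u, μ (ball (b : X × ℝ).1 (b : X × ℝ).2)
      ≤ ENNReal.ofReal (D * Cd) * μ (ball c r) := by
  have := hu.to_subtype
  set a := ballAverage μ f c (2 * r) with ha
  have h2r : 0 < 2 * r := by positivity
  have hD := hf.nonneg c
  have hint := hf.integrableOn_abs_sub hμ c h2r a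
  calc ENNReal.ofReal l * ∑' b : u, μ (ball (b : X × ℝ).1 (b : X × ℝ).2)
      = ∑' b : u, ENNReal.ofReal l * μ (ball (b : X × ℝ).1 (b : X × ℝ).2) :=
        ENNReal.tsum_mul_left.symm
    _ ≤ ∑' b : u, ∫⁻ y in ball (b : X × ℝ).1 (b : X × ℝ).2, ENNReal.ofReal |f y - a| ∂μ := by
        refine ENNReal.tsum_le_tsum fun b => ?_
        obtain ⟨h0, hsub, hlt⟩ := h b b.2
        have hfin := (hμ.measure_ball_lt_top (b : X × ℝ).1 h0).ne
        rw [← ofReal_integral_eq_lintegral_ofReal (hint.mono_set hsub)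
          (Filter.Eventually.of_forall fun _ => abs_nonneg _), ← ENNReal.ofReal_toReal hfin,
          ← ENNReal.ofReal_mul hl]
        refine ENNReal.ofReal_le_ofReal ?_
        refine le_trans ?_ (abs_setAverage_sub_le (hμ.real_ball_pos _ h0) hfin
          (hf.integrableOn _ _) a)
        rw [mul_comm]
        refine mul_le_mul_of_nonneg_left ?_ measureReal_nonneg
        rw [abs_sub_comm]
        exact hlt.le.trans (le_abs_self _)
    _ = ∫⁻ y in ⋃ b : u, ball (b : X × ℝ).1 (b : X × ℝ).2, ENNReal.ofReal |f y - a| ∂μ :=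
        (lintegral_iUnion (s := fun b : u => ball (b : X × ℝ).1 (b : X × ℝ).2)
          (fun _ => measurableSet_ball)
          (fun i j hij => hdisj i.2 j.2 (fun e => hij (Subtype.ext e))) _).symm
    _ ≤ ∫⁻ y in ball c (2 * r), ENNReal.ofReal |f y - a| ∂μ :=
        lintegral_mono_set (Set.iUnion_subset fun b => (h b b.2).2.1)
    _ = ENNReal.ofReal (∫ y in ball c (2 * r), |f y - a| ∂μ) :=
        (ofReal_integral_eq_lintegral_ofReal hint
          (Filter.Eventually.of_forall fun _ => abs_nonneg _)).symm
    _ ≤ ENNReal.ofReal (D * μ.real (ball c (2 * r))) :=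
        ENNReal.ofReal_le_ofReal (hf.integral_le hμ c h2r)
    _ = ENNReal.ofReal D * μ (ball c (2 * r)) := by
        rw [ENNReal.ofReal_mul hD, measureReal_def,
          ENNReal.ofReal_toReal (hμ.measure_ball_lt_top c h2r).ne]
    _ ≤ ENNReal.ofReal D * (ENNReal.ofReal Cd * μ (ball c r)) := by
        gcongr; exact (hμ c r hr).2.1
    _ = _ := by rw [ENNReal.ofReal_mul hD, mul_assoc]

theorem OscLE.averageDrop_le (hf : OscLE μ f D) (hμ : IsDoubling μ Cd) (hCd : 1 < Cd)
    {c x y : X} {r s ε l : ℝ} (hε : 0 < ε) (hl : 0 ≤ l) (hεs : ε ≤ s)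
    (hsr : s ≤ r / 10) (hne : (ball y s ∩ ball c r).Nonempty) (hxy : x ∈ ball y (5 * s))
    (hmax : ∀ c' t, ε ≤ t → t ≤ r / 10 → x ∈ ball c' t →
      l < ballAverage μ f c (2 * r) - ballAverage μ f c' t → t ≤ 4 * s) :
    averageDrop μ f c r ε x ≤ averageDrop μ f y (5 * s) ε x
      + ENNReal.ofReal (l + 4 * Cd ^ 7 * D) := by
  have hs : 0 < s := hε.trans_le hεs
  have hD := hf.nonneg x
  have hK : 0 ≤ 2 * Cd ^ 7 * D := by positivity
  have hdxy := mem_ball.1 hxy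
  have h10 : (0 : ℝ) < 10 * s := by positivity
  -- The reference averages differ by O(l + D). If radius 5s is admissible, it exceeds 4s, so `ball
  -- x (5 * s)` has drop at most l; otherwise s is comparable to r and the two reference balls are
  -- comparable.
  have hA : ballAverage μ f c (2 * r) - ballAverage μ f y (2 * (5 * s)) ≤ l + 2 * Cd ^ 7 * D := by
    rw [show 2 * (5 * s) = 10 * s by ring]
    rcases le_or_gt (5 * s) (r / 10) with h | h
    · have h1 : ballAverage μ f c (2 * r) - ballAverage μ f x (5 * s) ≤ l := by
        by_contra! hcon
        have := hmax x (5 * s) (by linarith) h (mem_ball_self (by positivity)) hcon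
        linarith
      have h2 := (abs_le.1 (hf.abs_sub_le hμ hCd 6 (x := x) (y := y) (r := 5 * s) (s := 10 * s)
        (by positivity) h10 (by linarith) (by linarith))).2
      norm_num only at h2
      linarith
    · obtain ⟨z, hz1, hz2⟩ := hne
      have := dist_triangle_left c y z
      rw [mem_ball] at hz1 hz2
      have h2 := (abs_le.1 (hf.abs_sub_le hμ hCd 6 (x := c) (y := y) (r := 2 * r) (s := 10 * s)
        (by linarith) h10 (by linarith) (by linarith))).2
      norm_num only at h2
      linarith
  refine iSup_le fun c' => iSup_le fun t => iSup_le fun ⟨h1, h2, h3⟩ => ?_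
  have ht : 0 < t := hε.trans_le h1
  rcases le_or_gt (ballAverage μ f c (2 * r) - ballAverage μ f c' t) l with hle | hgt
  · refine le_add_left (ENNReal.ofReal_le_ofReal ?_)
    linarith
  · have h4 := hmax c' t h1 h2 h3 hgt
    -- Smaller t is admissible for the drop of `ball y (5 * s)`; for s / 2 < t ≤ 4 * s the ball is
    -- comparable to `ball y (10 * s)`.
    rcases le_or_gt t (5 * s / 10) with h5 | h5
    · refine le_trans (ENNReal.ofReal_le_ofReal (q :=
        (ballAverage μ f y (2 * (5 * s)) - ballAverage μ f c' t) + (l + 4 * Cd ^ 7 * D)) ?_)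
        (ENNReal.ofReal_add_le.trans (add_le_add_left (le_averageDrop h1 h5 h3) _))
      linarith
    · refine le_add_left (ENNReal.ofReal_le_ofReal ?_)
      have := dist_triangle_left y c' x
      rw [mem_ball] at h3
      have h2 := (abs_le.1 (hf.abs_sub_le hμ hCd 6 (x := y) (y := c') (r := 10 * s) (s := t)
        h10 ht (by linarith) (by linarith))).2
      norm_num only at h2
      rw [show 2 * (5 * s) = 10 * s by ring] at hA
      linarith

theorem OscLE.lintegral_averageDrop_le_of_lt [BorelSpace X] (hf : OscLE μ f D)
    (hμ : IsDoubling μ Cd) (hCd : 1 < Cd) (hD : 0 < D) {ε : ℝ} (hε : 0 < ε) (n : ℕ) (c : X)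
    {r : ℝ} (hr : 0 < r) (hrn : r < 2 ^ n * ε) :
    ∫⁻ x in ball c r, averageDrop μ f c r ε x ∂μ
      ≤ ENNReal.ofReal (14 * Cd ^ 7 * D) * μ (ball c r) := by
  have hμσ := hμ.sigmaFinite
  induction n generalizing c r with
  | zero =>
    have h0 : ∀ x, averageDrop μ f c r ε x = 0 := fun x => by
      refine le_antisymm (iSup_le fun c' => iSup_le fun t => iSup_le fun ⟨h1, h2, h3⟩ => ?_)
        zero_le
      rw [pow_zero, one_mul] at hrn
      linarith
    simp [h0]
  | succ n ih =>
    -- This threshold makes the contraction factor Cd ^ 3 * (D * Cd) / l equal to 1/2: Cd ^ 3 from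
    -- enlarging the selected balls, D * Cd from `OscLE.mul_tsum_measure_le`.
    set l := 2 * Cd ^ 4 * D with hl
    have hl0 : 0 < l := by positivity
    have hK : 0 < 4 * Cd ^ 7 * D := by positivity
    obtain ⟨u, hdisj, hu, hcov⟩ := exists_disjoint_balls_of_lt_averageDrop (μ := μ) (f := f)
      c r hε hl0.le
    have hu0 : ∀ b ∈ u, 0 < b.2 := fun b hb => hε.trans_le (hu b hb).1
    have hcount : u.Countable := by
      have h1 := Measure.countable_meas_pos_of_disjoint_iUnion (μ := μ)
        (As := fun b : u => ball (b : X × ℝ).1 (b : X × ℝ).2) (fun _ => measurableSet_ball)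
        (fun i j hij => hdisj i.2 j.2 (fun e => hij (Subtype.ext e)))
      have h2 : {b : u | 0 < μ (ball (b : X × ℝ).1 (b : X × ℝ).2)} = Set.univ :=
        Set.eq_univ_of_forall fun b => hμ.measure_ball_pos _ (hu0 b b.2)
      rw [h2, Set.countable_univ_iff] at h1
      exact Set.countable_coe_iff.1 h1
    have := hcount.to_subtype
    have hmass := hf.mul_tsum_measure_le hμ c hr hl0.le hcount hdisj (fun b hb => by
      obtain ⟨h1, h2, ⟨z, hz1, hz2⟩, h4⟩ := hu b hb
      refine ⟨hu0 b hb, ball_subset_ball' ?_, h4⟩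
      have := dist_triangle_left b.1 c z
      rw [mem_ball] at hz1 hz2
      linarith)
    have hsplit : ball c r ⊆ {x ∈ ball c r | averageDrop μ f c r ε x ≤ ENNReal.ofReal l} ∪
        ⋃ b : u, {x ∈ ball c r ∩ ball (b : X × ℝ).1 (5 * (b : X × ℝ).2) |
          averageDrop μ f c r ε x ≤ averageDrop μ f (b : X × ℝ).1 (5 * (b : X × ℝ).2) ε x
            + ENNReal.ofReal (l + 4 * Cd ^ 7 * D)} := by
      intro x hx
      rcases le_or_gt (averageDrop μ f c r ε x) (ENNReal.ofReal l) with h | h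
      · exact Or.inl ⟨hx, h⟩
      · obtain ⟨b, hb, hxb, hmax⟩ := hcov x hx h
        obtain ⟨h1, h2, h3, h4⟩ := hu b hb
        exact Or.inr (Set.mem_iUnion.2 ⟨⟨b, hb⟩, ⟨hx, hxb⟩,
          hf.averageDrop_le hμ hCd hε hl0.le h1 h2 h3 hxb hmax⟩)
    have hmeas := measurable_averageDrop (μ := μ) (f := f)
    have hgood : ∫⁻ x in {x ∈ ball c r | averageDrop μ f c r ε x ≤ ENNReal.ofReal l},
        averageDrop μ f c r ε x ∂μ ≤ ENNReal.ofReal l * μ (ball c r) := by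
      refine (setLIntegral_mono' (measurableSet_ball.inter
        (measurableSet_le (hmeas c r ε) measurable_const)) (fun x hx => hx.2)).trans ?_
      rw [setLIntegral_const]
      gcongr
      exact Set.sep_subset _ _
    have hbad : ∀ b : u, ∫⁻ x in {x ∈ ball c r ∩ ball (b : X × ℝ).1 (5 * (b : X × ℝ).2) |
          averageDrop μ f c r ε x ≤ averageDrop μ f (b : X × ℝ).1 (5 * (b : X × ℝ).2) ε x
            + ENNReal.ofReal (l + 4 * Cd ^ 7 * D)}, averageDrop μ f c r ε x ∂μ
        ≤ ENNReal.ofReal (14 * Cd ^ 7 * D + (l + 4 * Cd ^ 7 * D)) * (ENNReal.ofReal (Cd ^ 3) *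
          μ (ball (b : X × ℝ).1 (b : X × ℝ).2)) := by
      rintro ⟨b, hb⟩
      have hb0 := hu0 b hb
      obtain ⟨h1, h2, -⟩ := hu b hb
      simp only
      calc _ ≤ ∫⁻ x in {x ∈ ball c r ∩ ball b.1 (5 * b.2) |
            averageDrop μ f c r ε x ≤ averageDrop μ f b.1 (5 * b.2) ε x
            + ENNReal.ofReal (l + 4 * Cd ^ 7 * D)}, (averageDrop μ f b.1 (5 * b.2) ε x
            + ENNReal.ofReal (l + 4 * Cd ^ 7 * D)) ∂μ :=
            setLIntegral_mono' ((measurableSet_ball.inter measurableSet_ball).inter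
              (measurableSet_le (hmeas c r ε) ((hmeas _ _ _).add measurable_const)))
              (fun x hx => hx.2)
        _ ≤ ∫⁻ x in ball b.1 (5 * b.2), (averageDrop μ f b.1 (5 * b.2) ε x
            + ENNReal.ofReal (l + 4 * Cd ^ 7 * D)) ∂μ :=
            lintegral_mono_set fun x hx => hx.1.2
        _ = ∫⁻ x in ball b.1 (5 * b.2), averageDrop μ f b.1 (5 * b.2) ε x ∂μ
            + ENNReal.ofReal (l + 4 * Cd ^ 7 * D) * μ (ball b.1 (5 * b.2)) := by
            rw [lintegral_add_right _ measurable_const, setLIntegral_const]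
        _ ≤ ENNReal.ofReal (14 * Cd ^ 7 * D) * μ (ball b.1 (5 * b.2))
            + ENNReal.ofReal (l + 4 * Cd ^ 7 * D) * μ (ball b.1 (5 * b.2)) := by
            gcongr
            refine ih _ (by positivity) ?_
            rw [pow_succ] at hrn
            linarith
        _ = ENNReal.ofReal (14 * Cd ^ 7 * D + (l + 4 * Cd ^ 7 * D)) * μ (ball b.1 (5 * b.2)) := by
            rw [← add_mul, ← ENNReal.ofReal_add (by positivity) (by positivity)]
        _ ≤ _ := by
            gcongr
            refine hμ.measure_ball_le hCd 3 hb0 ?_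
            rw [dist_self]
            linarith
    calc ∫⁻ x in ball c r, averageDrop μ f c r ε x ∂μ
        ≤ _ := lintegral_mono_set hsplit
      _ ≤ _ := lintegral_union_le _ _ _
      _ ≤ ENNReal.ofReal l * μ (ball c r) + ∑' b : u,
          ENNReal.ofReal (14 * Cd ^ 7 * D + (l + 4 * Cd ^ 7 * D)) * (ENNReal.ofReal (Cd ^ 3) *
          μ (ball (b : X × ℝ).1 (b : X × ℝ).2)) := by
          refine add_le_add hgood ((lintegral_iUnion_le _ _).trans ?_)
          exact ENNReal.tsum_le_tsum hbad
      _ = ENNReal.ofReal l * μ (ball c r) +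
          ENNReal.ofReal ((14 * Cd ^ 7 * D + (l + 4 * Cd ^ 7 * D)) * Cd ^ 3 / l) *
          (ENNReal.ofReal l * ∑' b : u, μ (ball (b : X × ℝ).1 (b : X × ℝ).2)) := by
          rw [ENNReal.tsum_mul_left, ENNReal.tsum_mul_left, ← mul_assoc, ← mul_assoc,
            ← ENNReal.ofReal_mul (by positivity), ← ENNReal.ofReal_mul (by positivity),
            div_mul_cancel₀ _ hl0.ne']
      _ ≤ ENNReal.ofReal l * μ (ball c r) +
          ENNReal.ofReal ((14 * Cd ^ 7 * D + (l + 4 * Cd ^ 7 * D)) * Cd ^ 3 / l) *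
          (ENNReal.ofReal (D * Cd) * μ (ball c r)) := by gcongr
      _ = ENNReal.ofReal (l + (14 * Cd ^ 7 * D + (l + 4 * Cd ^ 7 * D)) * Cd ^ 3 / l * (D * Cd)) *
          μ (ball c r) := by
          rw [← mul_assoc, ← ENNReal.ofReal_mul (by positivity), ← add_mul,
            ← ENNReal.ofReal_add (by positivity) (by positivity)]
      _ ≤ _ := by
          gcongr
          have e : (14 * Cd ^ 7 * D + (l + 4 * Cd ^ 7 * D)) * Cd ^ 3 / l * (D * Cd)
              = (14 * Cd ^ 7 * D + (l + 4 * Cd ^ 7 * D)) / 2 := by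
            rw [hl]; field_simp
          have h47 : Cd ^ 4 * D ≤ Cd ^ 7 * D := by
            gcongr
            · exact hCd.le
            · norm_num
          rw [e, hl]
          nlinarith

theorem OscLE.lintegral_averageDrop_le [BorelSpace X] (hf : OscLE μ f D)
    (hμ : IsDoubling μ Cd) (hCd : 1 < Cd) (hD : 0 < D) (c : X) {r : ℝ} (hr : 0 < r) :
    ∫⁻ x in ball c r, ⨆ n : ℕ, averageDrop μ f c r (1 / ((n : ℝ) + 1)) x ∂μ
      ≤ ENNReal.ofReal (14 * Cd ^ 7 * D) * μ (ball c r) := by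
  rw [lintegral_iSup (fun n => measurable_averageDrop _ _ _)]
  · refine iSup_le fun n => ?_
    have hε : 0 < 1 / ((n : ℝ) + 1) := by positivity
    obtain ⟨k, hk⟩ := pow_unbounded_of_one_lt (r / (1 / ((n : ℝ) + 1)))
      (one_lt_two : (1 : ℝ) < 2)
    exact hf.lintegral_averageDrop_le_of_lt hμ hCd hD hε k c hr ((div_lt_iff₀ hε).1 hk)
  · intro m n hmn x
    refine iSup_le fun c' => iSup_le fun t => iSup_le fun ⟨h1, h2, h3⟩ => ?_
    exact le_averageDrop ((one_div_le_one_div_of_le (by positivity) (by gcongr)).trans h1) h2 h3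

end AverageDrop

/-! ### From the drop estimate to BUO bounds for the minimal functions. -/

section NaturalMinimal

variable {μ : Measure X} {Cd D : ℝ} {f : X → ℝ}

theorem naturalMinimal_le {c x : X} {r : ℝ} (hr : 0 < r) (hx : x ∈ ball c r) :
    naturalMinimal μ f x ≤ (ballAverage μ f c r : EReal) :=
  iInf_le_of_le c <| iInf_le_of_le r <| iInf_le_of_le hr <| iInf_le_of_le hx le_rfl

theorem naturalMinimal_ne_top (x : X) : naturalMinimal μ f x ≠ ⊤ :=
  ne_top_of_le_ne_top (EReal.coe_ne_top _) (naturalMinimal_le one_pos (mem_ball_self one_pos))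

theorem measurable_naturalMinimal [BorelSpace X] : Measurable (naturalMinimal μ f) := by
  refine measurable_of_Iio fun a => IsOpen.measurableSet ?_
  refine isOpen_iff_mem_nhds.2 fun x hx => ?_
  simp only [Set.mem_preimage, Set.mem_Iio, naturalMinimal, iInf_lt_iff] at hx
  obtain ⟨c, r, hr, hxc, h⟩ := hx
  filter_upwards [isOpen_ball.mem_nhds hxc] with y hy
  exact (naturalMinimal_le hr hy).trans_lt h

/-- The upper envelope of `averageDrop` over all scales. -/
noncomputable def totalDrop (μ : Measure X) (f : X → ℝ) (c : X) (r : ℝ) (x : X) : ENNReal :=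
  ⨆ n : ℕ, averageDrop μ f c r (1 / ((n : ℝ) + 1)) x

theorem le_totalDrop {c c' x : X} {r s : ℝ} (h1 : 0 < s) (h2 : s ≤ r / 10)
    (h3 : x ∈ ball c' s) :
    ENNReal.ofReal (ballAverage μ f c (2 * r) - ballAverage μ f c' s) ≤ totalDrop μ f c r x := by
  obtain ⟨n, hn⟩ := exists_nat_one_div_lt h1
  exact (le_averageDrop hn.le h2 h3).trans (le_iSup (fun n : ℕ =>
    averageDrop μ f c r (1 / ((n : ℝ) + 1)) x) n)

theorem measurable_totalDrop [BorelSpace X] (c : X) (r : ℝ) :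
    Measurable (totalDrop μ f c r) :=
  Measurable.iSup fun _ => measurable_averageDrop _ _ _

theorem OscLE.sub_le_naturalMinimal (hf : OscLE μ f D) (hμ : IsDoubling μ Cd) (hCd : 1 < Cd)
    {c x y : X} {r v : ℝ} (hx : x ∈ ball c r) (hy : y ∈ ball c r)
    (hv : (v : EReal) ≤ naturalMinimal μ f y) (hN : totalDrop μ f c r x ≠ ⊤) :
    ((v - Cd ^ 5 * D - (totalDrop μ f c r x).toReal : ℝ) : EReal) ≤ naturalMinimal μ f x := by
  have hD := hf.nonneg x
  have hK : 0 ≤ Cd ^ 5 * D := by positivity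
  have hr : 0 < r := dist_nonneg.trans_lt (mem_ball.1 hx)
  refine le_iInf fun c' => le_iInf fun s => le_iInf fun hs => le_iInf fun hxs => ?_
  rw [EReal.coe_le_coe_iff]
  rcases le_or_gt s (r / 10) with h | h
  · have h1 : v ≤ ballAverage μ f c (2 * r) := EReal.coe_le_coe_iff.1
      (hv.trans (naturalMinimal_le (by positivity) (ball_subset_ball (by linarith) hy)))
    have h2 := (ENNReal.ofReal_le_iff_le_toReal hN).1 (le_totalDrop (μ := μ) (f := f) hs h hxs)
    linarith
  · have hxs' := mem_ball.1 hxs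
    -- Since r < 10 * s, dist y c' < 2 * r + s < 21 * s; 32 is the next power of 2.
    have hy' : y ∈ ball c' (32 * s) := by
      rw [mem_ball] at *
      have := dist_triangle y x c'
      have := dist_triangle_right y x c
      linarith
    have h1 : v ≤ ballAverage μ f c' (32 * s) := EReal.coe_le_coe_iff.1
      (hv.trans (naturalMinimal_le (by positivity) hy'))
    have h2 := (abs_le.1 (hf.abs_sub_le_of_subset hμ hCd 5 (x := c') (y := c') (s := 32 * s) hs
      (by positivity) (ball_subset_ball (by linarith)) (by rw [dist_self]; linarith))).1
    have h3 : 0 ≤ (totalDrop μ f c r x).toReal := ENNReal.toReal_nonneg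
    linarith

theorem OscLE.ae_totalDrop_lt_top [BorelSpace X] (hf : OscLE μ f D) (hμ : IsDoubling μ Cd)
    (hCd : 1 < Cd) (hD : 0 < D) (c : X) {r : ℝ} (hr : 0 < r) :
    ∀ᵐ x ∂μ.restrict (ball c r), totalDrop μ f c r x < ⊤ :=
  ae_lt_top (measurable_totalDrop c r) (ne_top_of_le_ne_top
    (ENNReal.mul_ne_top ENNReal.ofReal_ne_top (hμ.measure_ball_lt_top c hr).ne)
    (hf.lintegral_averageDrop_le hμ hCd hD c hr))

theorem OscLE.integrableOn_totalDrop [BorelSpace X] (hf : OscLE μ f D) (hμ : IsDoubling μ Cd)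
    (hCd : 1 < Cd) (hD : 0 < D) (c : X) {r : ℝ} (hr : 0 < r) :
    IntegrableOn (fun x => (totalDrop μ f c r x).toReal) (ball c r) μ :=
  integrable_toReal_of_lintegral_ne_top (measurable_totalDrop c r).aemeasurable
    (ne_top_of_le_ne_top
      (ENNReal.mul_ne_top ENNReal.ofReal_ne_top (hμ.measure_ball_lt_top c hr).ne)
      (hf.lintegral_averageDrop_le hμ hCd hD c hr))

theorem OscLE.integral_totalDrop_le [BorelSpace X] (hf : OscLE μ f D) (hμ : IsDoubling μ Cd)
    (hCd : 1 < Cd) (hD : 0 < D) (c : X) {r : ℝ} (hr : 0 < r) :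
    ∫ x in ball c r, (totalDrop μ f c r x).toReal ∂μ ≤ 14 * Cd ^ 7 * D * μ.real (ball c r) := by
  rw [integral_toReal (measurable_totalDrop c r).aemeasurable
    (hf.ae_totalDrop_lt_top hμ hCd hD c hr)]
  have h := ENNReal.toReal_mono
    (ENNReal.mul_ne_top ENNReal.ofReal_ne_top (hμ.measure_ball_lt_top c hr).ne)
    (hf.lintegral_averageDrop_le hμ hCd hD c hr)
  rwa [ENNReal.toReal_mul, ENNReal.toReal_ofReal (by positivity)] at h

theorem OscLE.ae_naturalMinimal [BorelSpace X] (hf : OscLE μ f D) (hμ : IsDoubling μ Cd)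
    (hCd : 1 < Cd) (hD : 0 < D) {c y : X} {r v : ℝ} (hy : y ∈ ball c r)
    (hv : (v : EReal) ≤ naturalMinimal μ f y) :
    ∀ᵐ x ∂μ.restrict (ball c r), naturalMinimal μ f x ≠ ⊥ ∧
      v - Cd ^ 5 * D - (totalDrop μ f c r x).toReal ≤ (naturalMinimal μ f x).toReal ∧
      (naturalMinimal μ f x).toReal ≤ ballAverage μ f c r := by
  have hr : 0 < r := dist_nonneg.trans_lt (mem_ball.1 hy)
  filter_upwards [hf.ae_totalDrop_lt_top hμ hCd hD c hr, ae_restrict_mem measurableSet_ball]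
    with x hN hx
  have h := hf.sub_le_naturalMinimal hμ hCd hx hy hv hN.ne
  have hbot : naturalMinimal μ f x ≠ ⊥ := ne_bot_of_le_ne_bot (EReal.coe_ne_bot _) h
  have h2 := naturalMinimal_le (μ := μ) (f := f) hr hx
  rw [← EReal.coe_toReal (naturalMinimal_ne_top x) hbot, EReal.coe_le_coe_iff] at h h2
  exact ⟨hbot, h, h2⟩

theorem OscLE.integrableOn_naturalMinimal [BorelSpace X] (hf : OscLE μ f D)
    (hμ : IsDoubling μ Cd) (hCd : 1 < Cd) (hD : 0 < D) {c y : X} {r v : ℝ} (hy : y ∈ ball c r)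
    (hv : (v : EReal) ≤ naturalMinimal μ f y) :
    IntegrableOn (fun x => (naturalMinimal μ f x).toReal) (ball c r) μ := by
  have hr : 0 < r := dist_nonneg.trans_lt (mem_ball.1 hy)
  have hfin := (hμ.measure_ball_lt_top c hr).ne
  refine integrable_of_le_of_le
    (g₁ := fun x => v - Cd ^ 5 * D - (totalDrop μ f c r x).toReal)
    (g₂ := fun _ => ballAverage μ f c r)
    measurable_naturalMinimal.ereal_toReal.aestronglyMeasurable ?_ ?_
    ((integrableOn_const hfin).sub (hf.integrableOn_totalDrop hμ hCd hD c hr))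
    (integrableOn_const hfin)
  · exact (hf.ae_naturalMinimal hμ hCd hD hy hv).mono fun x hx => hx.2.1
  · exact (hf.ae_naturalMinimal hμ hCd hD hy hv).mono fun x hx => hx.2.2

theorem OscLE.le_average_naturalMinimal [BorelSpace X] (hf : OscLE μ f D)
    (hμ : IsDoubling μ Cd) (hCd : 1 < Cd) (hD : 0 < D) {c y : X} {r v : ℝ} (hy : y ∈ ball c r)
    (hv : (v : EReal) ≤ naturalMinimal μ f y) :
    v ≤ (⨍ x in ball c r, (naturalMinimal μ f x).toReal ∂μ) + 15 * Cd ^ 7 * D := by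
  have hr : 0 < r := dist_nonneg.trans_lt (mem_ball.1 hy)
  have hfin := (hμ.measure_ball_lt_top c hr).ne
  have h0 := hμ.real_ball_pos c hr
  have hN := hf.integrableOn_totalDrop hμ hCd hD c hr
  have h1 : ∫ x in ball c r, (v - Cd ^ 5 * D - (totalDrop μ f c r x).toReal) ∂μ
      ≤ ∫ x in ball c r, (naturalMinimal μ f x).toReal ∂μ :=
    integral_mono_ae ((integrableOn_const hfin).sub hN)
      (hf.integrableOn_naturalMinimal hμ hCd hD hy hv)
      ((hf.ae_naturalMinimal hμ hCd hD hy hv).mono fun x hx => hx.2.1)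
  have hc : IntegrableOn (fun _ => v - Cd ^ 5 * D) (ball c r) μ := integrableOn_const hfin
  rw [integral_sub hc hN, setIntegral_const, smul_eq_mul] at h1
  have h2 := hf.integral_totalDrop_le hμ hCd hD c hr
  have h57 : Cd ^ 5 * D ≤ Cd ^ 7 * D := by
    gcongr
    · exact hCd.le
    · norm_num
  have h3 : μ.real (ball c r) * (v - 15 * Cd ^ 7 * D)
      ≤ ∫ x in ball c r, (naturalMinimal μ f x).toReal ∂μ := by nlinarith
  rw [← sub_le_iff_le_add, setAverage_eq, smul_eq_mul, le_inv_mul_iff₀ h0]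
  exact h3

theorem OscLE.memBUO_naturalMinimal [BorelSpace X] (hf : OscLE μ f D)
    (hμ : IsDoubling μ Cd) (hCd : 1 < Cd) (hD : 0 < D)
    (h : ∃ x, naturalMinimal μ f x ≠ ⊥) :
    MemBUO μ (naturalMinimal μ f) ∧
      buoNorm μ (naturalMinimal μ f) ≤ ((15 * Cd ^ 7 * D : ℝ) : EReal) := by
  obtain ⟨x₀, hx₀⟩ := h
  have hv : (((naturalMinimal μ f x₀).toReal : ℝ) : EReal) ≤ naturalMinimal μ f x₀ :=
    (EReal.coe_toReal (naturalMinimal_ne_top x₀) hx₀).le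
  have hb : buoNorm μ (naturalMinimal μ f) ≤ ((15 * Cd ^ 7 * D : ℝ) : EReal) := by
    refine iSup_le fun c => iSup_le fun r => iSup_le fun hr => ?_
    refine EReal.sub_le_of_le_add (essSup_le_of_ae_le _ ?_)
    filter_upwards [ae_restrict_mem measurableSet_ball] with y hy
    rcases eq_or_ne (naturalMinimal μ f y) ⊥ with hbot | hbot
    · simp [hbot]
    · have e := EReal.coe_toReal (naturalMinimal_ne_top (μ := μ) (f := f) y) hbot
      rw [← EReal.coe_add, ← e, EReal.coe_le_coe_iff, add_comm]
      exact hf.le_average_naturalMinimal hμ hCd hD hy e.le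
  refine ⟨⟨?_, fun y => ?_, hb.trans_lt (EReal.coe_lt_top _)⟩, hb⟩
  · have hcov : (⋃ n : ℕ, ball x₀ ((n : ℝ) + 1)) = Set.univ := by
      refine Set.eq_univ_of_forall fun y => Set.mem_iUnion.2 ?_
      obtain ⟨n, hn⟩ := exists_nat_gt (dist y x₀)
      exact ⟨n, mem_ball.2 (by linarith)⟩
    suffices h : ∀ᵐ x ∂μ.restrict (⋃ n : ℕ, ball x₀ ((n : ℝ) + 1)),
        naturalMinimal μ f x ≠ ⊥ ∧ naturalMinimal μ f x ≠ ⊤ by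
      rwa [hcov, Measure.restrict_univ] at h
    rw [ae_restrict_iUnion_iff]
    intro n
    filter_upwards [hf.ae_naturalMinimal hμ hCd hD
      (mem_ball_self (by positivity : 0 < (n : ℝ) + 1)) hv] with x hx
    exact ⟨hx.1, naturalMinimal_ne_top x⟩
  · refine ⟨ball x₀ (dist y x₀ + 1), isOpen_ball.mem_nhds (mem_ball.2 (by linarith)), ?_⟩
    exact hf.integrableOn_naturalMinimal hμ hCd hD (mem_ball_self (by positivity)) hv

/-- By the reverse triangle inequality |f| deviates from |a| by at most D on average; replacing |a|
by the average of |f| costs another D. -/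
theorem OscLE.abs (hf : OscLE μ f D) (hμ : IsDoubling μ Cd) :
    OscLE μ (fun x => |f x|) (2 * D) := by
  refine ⟨fun c r => (hf.integrableOn c r).abs, fun c r hr => ?_⟩
  set a := ballAverage μ f c r with ha
  set b := ballAverage μ (fun x => |f x|) c r with hb
  have h0 := hμ.real_ball_pos c hr
  have hfin := (hμ.measure_ball_lt_top c hr).ne
  have hi : IntegrableOn (fun y => |(|f y| - |a|)|) (ball c r) μ :=
    ((hf.integrableOn c r).abs.sub (integrableOn_const hfin)).abs
  have h1 : μ.real (ball c r) * |b - (|a|)| ≤ ∫ y in ball c r, |(|f y| - |a|)| ∂μ :=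
    abs_setAverage_sub_le h0 hfin (hf.integrableOn c r).abs |a|
  have h2 : ∫ y in ball c r, |(|f y| - |a|)| ∂μ ≤ ∫ y in ball c r, |f y - a| ∂μ :=
    integral_mono hi (hf.integrableOn_abs_sub hμ c hr a) fun y => abs_abs_sub_abs_le (f y) a
  have h3 : ∫ y in ball c r, |(|f y| - b)| ∂μ
      ≤ ∫ y in ball c r, (|(|f y| - |a|)| + |b - (|a|)|) ∂μ := by
    refine integral_mono ((hf.integrableOn c r).abs.sub (integrableOn_const hfin)).abs
      (hi.add (integrableOn_const hfin)) fun y => ?_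
    rw [abs_sub_comm b]
    exact _root_.abs_sub_le _ _ _
  have hc : IntegrableOn (fun _ => |b - (|a|)|) (ball c r) μ := integrableOn_const hfin
  rw [integral_add hi hc, setIntegral_const, smul_eq_mul] at h3
  have h4 := hf.integral_le hμ c hr
  rw [setAverage_eq, smul_eq_mul, inv_mul_le_iff₀ h0]
  linarith

theorem MemBMO.oscLE [BorelSpace X] [CompleteSpace X] (hf : MemBMO μ f) (hμ : IsDoubling μ Cd)
    (hCd : 1 < Cd) (hD : bmoNorm μ f ≤ (D : EReal)) : OscLE μ f D :=
  ⟨hμ.integrableOn_ball hCd hf.1, fun c r hr => EReal.coe_le_coe_iff.1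
    (iSup_le_iff.1 (iSup_le_iff.1 (iSup_le_iff.1 hD c) r) hr)⟩

theorem bmoNorm_nonneg [Nonempty X] : 0 ≤ bmoNorm μ f := by
  obtain ⟨x⟩ := ‹Nonempty X›
  refine le_iSup_of_le x <| le_iSup_of_le 1 <| le_iSup_of_le one_pos ?_
  rw [EReal.coe_nonneg, setAverage_eq]
  positivity

theorem memBUO_of_isEmpty [IsEmpty X] (g : X → EReal) : MemBUO μ g ∧ buoNorm μ g = ⊥ := by
  have h : buoNorm μ g = ⊥ := iSup_of_empty _
  refine ⟨⟨?_, fun x => isEmptyElim x, h ▸ bot_lt_top⟩, h⟩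
  exact Filter.Eventually.of_forall fun x => isEmptyElim x

/-- The stopping argument divides by l and needs D > 0, whereas the BMO norm B may vanish; the sharp
bound comes from letting D decrease to B. -/
theorem memBUO_naturalMinimal_of_forall_oscLE [BorelSpace X] {g : X → ℝ} {B k : ℝ}
    (hμ : IsDoubling μ Cd) (hCd : 1 < Cd) (hk : 0 < k) (hB : 0 ≤ B)
    (hg : ∀ D, B < D → OscLE μ g (k * D)) (h : ∃ x, naturalMinimal μ g x ≠ ⊥) :
    MemBUO μ (naturalMinimal μ g) ∧
      buoNorm μ (naturalMinimal μ g) ≤ ((15 * Cd ^ 7 * k * B : ℝ) : EReal) := by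
  have key : ∀ D, B < D → _ := fun D hD =>
    (hg D hD).memBUO_naturalMinimal hμ hCd (by have := hB.trans_lt hD; positivity) h
  refine ⟨(key (B + 1) (by linarith)).1, EReal.le_of_forall_lt_iff_le.1 fun z hz => ?_⟩
  have hc : 0 < 15 * Cd ^ 7 * k := by positivity
  have hzB : B < z / (15 * Cd ^ 7 * k) := by
    rw [lt_div_iff₀ hc, mul_comm]
    exact EReal.coe_lt_coe_iff.1 hz
  refine (key _ hzB).2.trans_eq ?_
  rw [← mul_assoc, mul_div_cancel₀ _ hc.ne']

end NaturalMinimal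

end MetricOscillation

theorem mainTheorem10 (Cd : ℝ) (hCd : 1 < Cd) :
    ∃ C : ℝ, 0 < C ∧
      ∀ (X : Type u) [MetricSpace X] [CompleteSpace X] [MeasurableSpace X] [BorelSpace X]
        (μ : Measure X),
        MetricOscillation.IsDoubling μ Cd →
        MetricOscillation.HasAnnularDecay μ →
        ∀ f : X → ℝ, MetricOscillation.MemBMO μ f →
          ((∃ x : X, MetricOscillation.naturalMinimal μ f x ≠ ⊥) →
            MetricOscillation.MemBUO μ (MetricOscillation.naturalMinimal μ f) ∧
            MetricOscillation.buoNorm μ (MetricOscillation.naturalMinimal μ f)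
              ≤ (C : EReal) * MetricOscillation.bmoNorm μ f) ∧
          (MetricOscillation.MemBUO μ (MetricOscillation.minimal μ f) ∧
            MetricOscillation.buoNorm μ (MetricOscillation.minimal μ f)
              ≤ (C : EReal) * MetricOscillation.bmoNorm μ f) := by
  refine ⟨15 * Cd ^ 7 * 2, by positivity, fun X _ _ _ _ μ hμ _ f hf => ?_⟩
  rcases isEmpty_or_nonempty X with hX | hX
  · have h := MetricOscillation.memBUO_of_isEmpty (μ := μ) (MetricOscillation.minimal μ f)
    exact ⟨fun ⟨x, _⟩ => isEmptyElim x, h.1, h.2 ▸ bot_le⟩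
  have h0 := MetricOscillation.bmoNorm_nonneg (μ := μ) (f := f)
  lift MetricOscillation.bmoNorm μ f to ℝ using
    ⟨hf.2.ne, ne_bot_of_le_ne_bot EReal.zero_ne_bot h0⟩ with B hB
  rw [EReal.coe_nonneg] at h0
  have hosc : ∀ D, B < D → MetricOscillation.OscLE μ f D := fun D hD =>
    hf.oscLE hμ hCd (hB ▸ EReal.coe_le_coe_iff.2 hD.le)
  rw [← EReal.coe_mul]
  refine ⟨fun h => ?_, ?_⟩
  · have h1 := MetricOscillation.memBUO_naturalMinimal_of_forall_oscLE hμ hCd one_pos h0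
      (fun D hD => (one_mul D).symm ▸ hosc D hD) h
    refine ⟨h1.1, h1.2.trans (EReal.coe_le_coe_iff.2 ?_)⟩
    gcongr
    norm_num
  · obtain ⟨x⟩ := hX
    -- `minimal μ f` is definitionally `naturalMinimal` of |f|, and it is nonnegative, hence never
    -- ⊥.
    refine MetricOscillation.memBUO_naturalMinimal_of_forall_oscLE hμ hCd two_pos h0
      (fun D hD => (hosc D hD).abs hμ) ⟨x, ?_⟩
    refine ne_bot_of_le_ne_bot EReal.zero_ne_bot ?_
    refine le_iInf fun c => le_iInf fun r => le_iInf fun _ => le_iInf fun _ => ?_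
    rw [EReal.coe_nonneg, setAverage_eq]
    positivity
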